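/- **Theorem ($\varepsilon$-optimal cheap fine-tuning).** Let $d,m,K$ be positive integers and $p\in\mathbb N$. Let $\ell:\mathbb R^m\times\mathbb R^m\to[0,\infty)$ be Lipschitz, let $f:\mathbb R^p\times\mathbb R^d\to\mathbb R^m$, $(\theta,x)\mapsto f_\theta(x)$, be locally Lipschitz, and let $\theta_0\in\mathbb R^p$. Let $\mathcal D$ be a set of Borel probability measures on $[0,1]^{d+m}$ with a metric $\rho$ such that $(\mathcal D,\rho)$ is compact and $\rho$ metrizes weak convergence on $\mathcal D$. Let $\mathbb P$ be a Borel probability measure on $\mathcal D$, let $D_1,\dots,D_K\in\mathcal D$ and $\Delta\theta_1,\dots,\Delta\theta_K\in\mathbb R^p$, and put $$\operatorname{co}(\Delta\theta)=\Big\{\sum_{k=1}^K w_k\,\Delta\theta_k:\ w\in[0,1]^K,\ \sum_{k=1}^K w_k=1\Big\}.$$ Assume that the map $\operatorname{align}:\mathcal D\to[0,\infty)^K$, $\operatorname{align}(D)=(\rho(D,D_k))_{k=1}^K$, is injective. Let $\varsigma:\mathbb R\to\mathbb R$ be Lipschitz, not affine, and differentiable with nonzero derivative at at least one point. Then for every $0<\varepsilon\le1$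 there is a multilayer perceptron $\hat f:\mathbb R^K\to\mathbb R^K$ with activation function $\varsigma$ (that is, a composition of affine maps alternating with the componentwise application of $\varsigma$, with at least one hidden layer) such that, with $$\mathcal C(D)=\sum_{k=1}^K \operatorname{softmin}\big(\hat f(\operatorname{align}(D))\big)_k\,\Delta\theta_k,\qquad \operatorname{softmin}(w)_k=\frac{e^{-w_k}}{\sum_{i=1}^K e^{-w_i}},$$ the set of all $D\in\mathcal D$ which satisfy $$\mathbb E_{(X,Y)\sim D}\big[\ell(f_{\theta_0+\mathcal C(D)}(X),Y)\big]\ \le\ \inf_{\vartheta\in\operatorname{co}(\Delta\theta)}\mathbb E_{(X,Y)\sim D}\big[\ell(f_{\theta_0+\vartheta}(X),Y)\big]+\varepsilon$$ is Borel and has $\mathbb P$-probability at least $1-\varepsilon$. -/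

import Mathlib

open MeasureTheory

noncomputable section

/-- The data domain `[0,1]^(d+m)`. A point is a pair (input, label): the first `d` coordinates are
the input, the last `m` coordinates are the label. -/
abbrev DataDomain (d m : ℕ) : Type := Fin (d + m) → unitInterval

/-- The input part `X ∈ ℝ^d` of a data point. -/
def inputOf {d m : ℕ} (z : DataDomain d m) : Fin d → ℝ := fun i => (z (Fin.castAdd m i) : ℝ)

/-- The label part `Y ∈ ℝ^m` of a data point. -/
def labelOf {d m : ℕ} (z : DataDomain d m) : Fin m → ℝ := fun j => (z (Fin.natAdd d j) : ℝ)

/-- `ρ` is a metric on the topological space `α` which generates the topology of `α`. -/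
structure Metrizes {α : Type*} [TopologicalSpace α] (ρ : α → α → ℝ) : Prop where
  dist_self : ∀ x, ρ x x = 0
  eq_of_dist_eq_zero : ∀ x y, ρ x y = 0 → x = y
  dist_comm : ∀ x y, ρ x y = ρ y x
  dist_triangle : ∀ x y z, ρ x z ≤ ρ x y + ρ y z
  isOpen_iff : ∀ s : Set α, IsOpen s ↔ ∀ x ∈ s, ∃ r > 0, ∀ y, ρ x y < r → y ∈ s

/-- Multilayer perceptrons with `n` inputs and `m` outputs: an affine output layer, preceded by any
number of hidden layers of arbitrary widths. -/
inductive MLP : ℕ → ℕ → Type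
  | output {n m : ℕ} (W : Matrix (Fin m) (Fin n) ℝ) (b : Fin m → ℝ) : MLP n m
  | hidden {n k m : ℕ} (W : Matrix (Fin k) (Fin n) ℝ) (b : Fin k → ℝ) (N : MLP k m) : MLP n m

/-- The number of hidden layers. -/
def MLP.hiddenLayers : {n m : ℕ} → MLP n m → ℕ
  | _, _, .output _ _ => 0
  | _, _, .hidden _ _ N => N.hiddenLayers + 1

/-- The function computed by an MLP whose activation function `σ` acts componentwise on each
hidden layer. -/
def MLP.eval (σ : ℝ → ℝ) : {n m : ℕ} → MLP n m → (Fin n → ℝ) → (Fin m → ℝ)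
  | _, _, .output W b, x => W.mulVec x + b
  | _, _, .hidden W b N, x => N.eval σ (fun i => σ ((W.mulVec x + b) i))

/-- `softmin(w)_k = exp(-w_k) / ∑ i, exp(-w_i)`. -/
def softmin {K : ℕ} (w : Fin K → ℝ) : Fin K → ℝ :=
  fun k => Real.exp (-w k) / ∑ i, Real.exp (-w i)

/-- The mixture `wᵀ (Δθ_1, …, Δθ_K) = ∑ k, w_k Δθ_k`. -/
def mixture {K p : ℕ} (w : Fin K → ℝ) (Δθ : Fin K → Fin p → ℝ) : Fin p → ℝ :=
  ∑ k, w k • Δθ k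

/-- `co(Δθ)`: all mixtures of `Δθ_1, …, Δθ_K` with weights in the probability simplex. -/
def coHull {K p : ℕ} (Δθ : Fin K → Fin p → ℝ) : Set (Fin p → ℝ) :=
  {ϑ | ∃ w ∈ stdSimplex ℝ (Fin K), ϑ = mixture w Δθ}

/-- `align(μ) = (ρ(μ, D_k))_k`. -/
def align {α : Type*} {K : ℕ} (ρ : α → α → ℝ) (D : Fin K → α) (μ : α) : Fin K → ℝ :=
  fun k => ρ μ (D k)

/-- The expected loss `E_{(X,Y) ∼ μ} [ℓ(f_{θ₀ + ϑ}(X), Y)]` of the parameter update `ϑ`. -/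
def expectedLoss {d m p : ℕ} (ℓ : (Fin m → ℝ) → (Fin m → ℝ) → ℝ)
    (f : (Fin p → ℝ) → (Fin d → ℝ) → (Fin m → ℝ)) (θ₀ : Fin p → ℝ)
    (μ : ProbabilityMeasure (DataDomain d m)) (ϑ : Fin p → ℝ) : ℝ :=
  ∫ z, ℓ (f (θ₀ + ϑ) (inputOf z)) (labelOf z) ∂(μ : Measure (DataDomain d m))

/-- The neural pipeline `μ ↦ softmin(MLP(align(μ)))ᵀ (Δθ_1, …, Δθ_K)`. -/
def cheapFineTuning {α : Type*} {K p : ℕ} (σ : ℝ → ℝ) (N : MLP K K) (ρ : α → α → ℝ)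
    (D : Fin K → α) (Δθ : Fin K → Fin p → ℝ) (μ : α) : Fin p → ℝ :=
  mixture (softmin (N.eval σ (align ρ D μ))) Δθ

end

/-!
Universal approximation rests on a soft argument. Let `A` be a closed subspace of `C(X, ℝ)`, with
`X` compact, which contains `1` and is stable under `g ↦ σ ∘ g`. For `g, k ∈ A`, the moving
average `∫ t in 0..h, σ (g + t)` lies in `A`, and its derivative in the direction `k`, which is
`(σ (g + h) - σ g) * k`, lies in `A` as well (`increment_mul_mem`). So the increments `σ (g + h) -
σ g` lie in the closed subalgebra of multipliers of `A`. As `σ` is not affine, some increment of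
`σ` is not constant, so the multipliers separate points whenever `A` does; by Stone–Weierstrass
every function is a multiplier, and `A = C(X, ℝ)` (`eq_top_of_comp_mem`). The closure of all
network functions is such an `A`: networks of different depths are compared by means of a point
where `σ' ≠ 0`, near which a hidden layer approximates the identity (`layerSpan_le_closure_succ`).

This is applied with `X = 𝒟` itself and the distances to the reference datasets as features, which
separate points because `align` is injective. The expected loss is jointly continuous in the
dataset and the parameter (`continuous_expectedLoss`), and its infimum over the compact set
`co(Δθ)` is continuous in the dataset, so that the pairs of a dataset and a logit vector whose
softmin mixture is strictly `ε`-optimal form an open set. Its fibres are non-empty since softmin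
weights are dense in the simplex (`exists_softmin_mixture_lt`). By compactness an open relation
with non-empty fibres has a simple selector with a uniform margin
(`exists_simpleFunc_ball_subset`); the selector is close to a continuous function in `L¹`, hence
outside a set of small probability by Markov's inequality, and the continuous function is
uniformly close to a network (`exists_mlp_measure_ge`).
-/

section

open Topology Filter Set

/-! ### Closed function spaces stable under a non-affine activation -/

section Density

variable {X : Type*} [TopologicalSpace X] [CompactSpace X]

/-- A curve in a closed subspace `A` of `C(X, ℝ)` integrates to an element of `A`, and the integral
can be evaluated pointwise. -/
theorem exists_mem_apply_eq_intervalIntegral {A : Submodule ℝ C(X, ℝ)}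
    (hA : IsClosed (A : Set C(X, ℝ))) {F : ℝ → C(X, ℝ)} (hF : Continuous F) (hFA : ∀ t, F t ∈ A)
    (a b : ℝ) : (∫ t in a..b, F t) ∈ A ∧ ∀ x, (∫ t in a..b, F t) x = ∫ t in a..b, F t x := by
  have : CompleteSpace A := hA.completeSpace_coe
  constructor
  · have := LinearIsometry.intervalIntegral_comp_comm (𝕜 := ℝ) (μ := volume) (a := a) (b := b)
      A.subtypeₗᵢ fun t => (⟨F t, hFA t⟩ : A)
    simp only [Submodule.coe_subtypeₗᵢ, Submodule.subtype_apply] at this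
    rw [this]
    exact Submodule.coe_mem _
  · intro x
    exact ((ContinuousMap.evalCLM ℝ x).intervalIntegral_comp_comm
      (hF.intervalIntegrable a b (μ := volume))).symm

/-- Some increment `x ↦ σ (x + h) - σ x` of a continuous non-affine function is not constant. -/
theorem exists_increment_ne {σ : ℝ → ℝ} (hσ : Continuous σ)
    (hσ_nonaffine : ¬ ∃ a b : ℝ, ∀ x, σ x = a * x + b) :
    ∃ h a b : ℝ, σ (a + h) - σ a ≠ σ (b + h) - σ b := by
  by_contra! H
  -- constant increments make `x ↦ σ x - σ 0` additive, hence linear by continuity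
  let τ : ℝ →+ ℝ :=
    { toFun := fun x => σ x - σ 0
      map_zero' := sub_self _
      map_add' := fun x y => by
        have := H y x 0
        rw [zero_add] at this
        linarith }
  have hτ : Continuous τ := hσ.sub continuous_const
  refine hσ_nonaffine ⟨τ 1, σ 0, fun x => ?_⟩
  have h1 : τ x = x * τ 1 := by
    simpa using map_real_smul τ hτ x 1
  have h2 : τ x = σ x - σ 0 := rfl
  linarith

/-- Differentiating the moving average `y ↦ ∫ t in 0..h, σ (y + t)` at `g` in the direction `k`
stays inside `A`: the derivative is the product of `k` with an increment of `σ` at `g`. -/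
theorem increment_mul_mem {A : Submodule ℝ C(X, ℝ)} (hA : IsClosed (A : Set C(X, ℝ)))
    (hA1 : 1 ∈ A) {σ : C(ℝ, ℝ)} (hAσ : ∀ g ∈ A, σ.comp g ∈ A) (h : ℝ) {g k : C(X, ℝ)}
    (hg : g ∈ A) (hk : k ∈ A) : (σ.comp (g + h • 1) - σ.comp g) * k ∈ A := by
  have hcomp : Continuous fun u : C(X, ℝ) => σ.comp u := ContinuousMap.continuous_postcomp σ
  -- the difference quotient of the moving average, written so that it extends to `s = 0`
  let F : ℝ → ℝ → C(X, ℝ) := fun s t =>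
    σ.comp (g + h • 1 + (s * t) • k) - σ.comp (g + (s * t) • k)
  have hF : Continuous (Function.uncurry F) := by
    have h1 : Continuous fun q : ℝ × ℝ => g + h • (1 : C(X, ℝ)) + (q.1 * q.2) • k := by fun_prop
    have h2 : Continuous fun q : ℝ × ℝ => g + (q.1 * q.2) • k := by fun_prop
    exact (hcomp.comp h1).sub (hcomp.comp h2)
  have hFA : ∀ s t, F s t ∈ A := fun s t =>
    A.sub_mem (hAσ _ (A.add_mem (A.add_mem hg (A.smul_mem _ hA1)) (A.smul_mem _ hk)))
      (hAσ _ (A.add_mem hg (A.smul_mem _ hk)))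
  let Ψ : ℝ → C(X, ℝ) := fun s => (∫ t in (0 : ℝ)..1, F s t) * k
  have hΨ : Continuous Ψ :=
    (intervalIntegral.continuous_parametric_intervalIntegral_of_continuous' hF 0 1).mul
      continuous_const
  let I : ℝ → C(X, ℝ) := fun s => ∫ t in (0 : ℝ)..h, σ.comp (g + s • k + t • 1)
  have hI : ∀ s, I s ∈ A ∧ ∀ x, I s x = ∫ t in (0 : ℝ)..h, σ (g x + s * k x + t) := by
    intro s
    have hc : Continuous fun t : ℝ => g + s • k + t • (1 : C(X, ℝ)) := by fun_prop
    have := exists_mem_apply_eq_intervalIntegral hA (hcomp.comp hc)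
      (fun t => hAσ _ (A.add_mem (A.add_mem hg (A.smul_mem s hk)) (A.smul_mem t hA1))) 0 h
    refine ⟨this.1, fun x => ?_⟩
    simpa using this.2 x
  have hint : ∀ a b : ℝ, IntervalIntegrable σ volume a b := fun a b =>
    σ.continuous.intervalIntegrable a b
  have key : ∀ s, s • Ψ s = I s - I 0 := by
    intro s
    ext x
    have e1 : (∫ t in (0 : ℝ)..1, F s t) x = ∫ t in (0 : ℝ)..1, F s t x :=
      (exists_mem_apply_eq_intervalIntegral hA
        (hF.comp (Continuous.prodMk continuous_const continuous_id)) (hFA s) 0 1).2 x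
    have e2 : ∀ y c : ℝ, c * ∫ t in (0 : ℝ)..1, σ (y + c * t) = ∫ t in y..y + c, σ t := by
      intro y c
      rw [intervalIntegral.mul_integral_comp_add_mul]
      simp
    have e3 : ∫ t in (0 : ℝ)..1, F s t x
        = (∫ t in (0 : ℝ)..1, σ (g x + h + (s * k x) * t))
          - ∫ t in (0 : ℝ)..1, σ (g x + (s * k x) * t) := by
      rw [← intervalIntegral.integral_sub]
      · refine intervalIntegral.integral_congr fun t _ => ?_
        simp [F, mul_right_comm]
      · exact Continuous.intervalIntegrable (by fun_prop) _ _
      · exact Continuous.intervalIntegrable (by fun_prop) _ _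
    have e4 : ∀ y : ℝ, ∫ t in (0 : ℝ)..h, σ (y + t) = ∫ t in y..y + h, σ t := by
      intro y
      simp
    have e5 := intervalIntegral.integral_interval_sub_interval_comm
      (hint (g x + h) (g x + h + s * k x)) (hint (g x) (g x + s * k x)) (hint (g x + h) (g x))
    have e6 := intervalIntegral.integral_symm (f := σ) (μ := volume) (g x) (g x + h)
    have e7 := intervalIntegral.integral_symm (f := σ) (μ := volume) (g x + s * k x)
      (g x + h + s * k x)
    have e8 : (s • Ψ s) x = (s * k x) * ∫ t in (0 : ℝ)..1, F s t x := by
      simp only [Ψ, ContinuousMap.smul_apply, ContinuousMap.mul_apply, e1, smul_eq_mul]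
      ring
    rw [e8, e3, mul_sub, e2, e2, ContinuousMap.sub_apply, (hI s).2, (hI 0).2, zero_mul, add_zero,
      e4, e4, e5, e6, e7, add_right_comm]
    ring
  have hne : ∀ s ≠ 0, Ψ s ∈ A := by
    intro s hs
    have : Ψ s = s⁻¹ • (I s - I 0) := by rw [← key, inv_smul_smul₀ hs]
    rw [this]
    exact A.smul_mem _ (A.sub_mem (hI s).1 (hI 0).1)
  have h0 : Ψ 0 = (σ.comp (g + h • 1) - σ.comp g) * k := by
    simp [Ψ, F]
  rw [← h0]
  refine hA.mem_of_tendsto (b := 𝓝[≠] (0 : ℝ))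
    ((hΨ.tendsto 0).mono_left nhdsWithin_le_nhds) ?_
  filter_upwards [self_mem_nhdsWithin] with s hs using hne s hs

/-- The multipliers of a subspace `A` of an algebra of functions: the `u` with `u A ⊆ A`. -/
def multiplierSubalgebra (A : Submodule ℝ C(X, ℝ)) : Subalgebra ℝ C(X, ℝ) where
  carrier := {u | ∀ k ∈ A, u * k ∈ A}
  mul_mem' := fun {u v} hu hv k hk => by
    rw [mul_assoc]
    exact hu _ (hv _ hk)
  add_mem' := fun {u v} hu hv k hk => by
    rw [add_mul]
    exact A.add_mem (hu _ hk) (hv _ hk)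
  algebraMap_mem' := fun r k hk => by
    rw [← Algebra.smul_def]
    exact A.smul_mem _ hk

/-- A closed space of continuous functions on a compact space that contains the constants,
separates points and is stable under a continuous non-affine activation is everything. -/
theorem eq_top_of_comp_mem {A : Submodule ℝ C(X, ℝ)} (hA : IsClosed (A : Set C(X, ℝ)))
    (hA1 : 1 ∈ A) {σ : C(ℝ, ℝ)} (hAσ : ∀ g ∈ A, σ.comp g ∈ A)
    (hσ_nonaffine : ¬ ∃ a b : ℝ, ∀ x, σ x = a * x + b)
    (hsep : ∀ x y : X, x ≠ y → ∃ g ∈ A, g x ≠ g y) : A = ⊤ := by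
  obtain ⟨h, a, b, hab⟩ := exists_increment_ne σ.continuous hσ_nonaffine
  have hB : IsClosed (multiplierSubalgebra A : Set C(X, ℝ)) := by
    have : (multiplierSubalgebra A : Set C(X, ℝ))
        = ⋂ k ∈ A, (fun u => u * k) ⁻¹' (A : Set C(X, ℝ)) := by
      ext u
      simp [multiplierSubalgebra]
    rw [this]
    exact isClosed_biInter fun k _ => hA.preimage (by fun_prop)
  have hBsep : (multiplierSubalgebra A).SeparatesPoints := by
    intro x y hxy
    obtain ⟨g, hg, hgxy⟩ := hsep x y hxy
    have hd : g x - g y ≠ 0 := sub_ne_zero.2 hgxy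
    -- the affine function of `g` with values `a` at `x` and `b` at `y`
    let c : ℝ := (a - b) / (g x - g y)
    let u : C(X, ℝ) := c • g + (b - c * g y) • 1
    have hu : u ∈ A := A.add_mem (A.smul_mem _ hg) (A.smul_mem _ hA1)
    have hux : u x = a := by
      have : c * (g x - g y) = a - b := div_mul_cancel₀ _ hd
      simp only [u, ContinuousMap.add_apply, ContinuousMap.smul_apply, ContinuousMap.one_apply,
        smul_eq_mul]
      linarith
    have huy : u y = b := by simp [u]
    refine ⟨_, ⟨σ.comp (u + h • 1) - σ.comp u,
      fun k hk => increment_mul_mem hA hA1 hAσ h hu hk, rfl⟩, ?_⟩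
    simpa [hux, huy] using hab
  have hBtop : multiplierSubalgebra A = ⊤ := by
    rw [← ContinuousMap.subalgebra_topologicalClosure_eq_top_of_separatesPoints _ hBsep]
    exact SetLike.coe_injective hB.closure_eq.symm
  rw [eq_top_iff]
  intro u _
  have hu : u ∈ multiplierSubalgebra A := by rw [hBtop]; trivial
  simpa using hu 1 hA1

end Density

/-! ### Spaces of network functions -/

section Networks

variable {X : Type*} [TopologicalSpace X]

/-- The continuous functions on `X` which are scalar outputs of networks with exactly `n` hidden
layers, fed with the features `φ k : X → ℝ`. -/
def layerSpan {K : ℕ} (φ : Fin K → C(X, ℝ)) (σ : C(ℝ, ℝ)) : ℕ → Submodule ℝ C(X, ℝ)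
  | 0 => Submodule.span ℝ (insert 1 (range φ))
  | n + 1 => Submodule.span ℝ (insert 1 ((fun g => σ.comp g) '' (layerSpan φ σ n)))

theorem one_mem_layerSpan {K : ℕ} (φ : Fin K → C(X, ℝ)) (σ : C(ℝ, ℝ)) (n : ℕ) :
    1 ∈ layerSpan φ σ n := by
  cases n <;> exact Submodule.subset_span (mem_insert _ _)

theorem comp_mem_layerSpan {K : ℕ} {φ : Fin K → C(X, ℝ)} {σ : C(ℝ, ℝ)} {n : ℕ} {g : C(X, ℝ)}
    (hg : g ∈ layerSpan φ σ n) : σ.comp g ∈ layerSpan φ σ (n + 1) :=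
  Submodule.subset_span (mem_insert_of_mem _ (mem_image_of_mem _ hg))

/-- A network can be continued by one more application of the activation and an affine layer. -/
theorem MLP.exists_snoc (σ : ℝ → ℝ) {n k : ℕ} (N : MLP n k) {m : ℕ}
    (W : Matrix (Fin m) (Fin k) ℝ) (b : Fin m → ℝ) :
    ∃ N' : MLP n m, N'.hiddenLayers = N.hiddenLayers + 1 ∧
      ∀ x, N'.eval σ x = W.mulVec (fun i => σ (N.eval σ x i)) + b := by
  induction N with
  | output W' b' => exact ⟨.hidden W' b' (.output W b), rfl, fun x => rfl⟩
  | hidden W' b' N ih =>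
    obtain ⟨N', h1, h2⟩ := ih W
    exact ⟨.hidden W' b' N', by simp [MLP.hiddenLayers, h1], fun x => by simp [MLP.eval, h2]⟩

/-- Finitely many elements of the span of `insert e S` are affine combinations of the same finitely
many elements of `S`, with `e` as the constant. -/
theorem exists_finite_affine_combination {E : Type*} [AddCommGroup E] [Module ℝ E] {e : E}
    {S : Set E} {m : ℕ} {g : Fin m → E} (hg : ∀ i, g i ∈ Submodule.span ℝ (insert e S)) :
    ∃ (k : ℕ) (u : Fin k → E) (W : Matrix (Fin m) (Fin k) ℝ) (b : Fin m → ℝ),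
      (∀ j, u j ∈ S) ∧ ∀ i, g i = ∑ j, W i j • u j + b i • e := by
  classical
  choose b z hz hgz using fun i => Submodule.mem_span_insert.1 (hg i)
  choose T hT hzT using fun i => Submodule.mem_span_finite_of_mem_span (hz i)
  let U : Finset E := Finset.univ.biUnion T
  have hzU : ∀ i, z i ∈ Submodule.span ℝ (U : Set E) := fun i =>
    Submodule.span_mono (Finset.coe_subset.2 (Finset.subset_biUnion_of_mem T (Finset.mem_univ i)))
      (hzT i)
  choose c _ hcz using fun i => Submodule.mem_span_finset.1 (hzU i)
  refine ⟨U.card, fun j => (U.equivFin.symm j : E), fun i j => c i (U.equivFin.symm j), b,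
    fun j => ?_, fun i => ?_⟩
  · obtain ⟨i, _, hi⟩ := Finset.mem_biUnion.1 (U.equivFin.symm j).2
    exact hT i hi
  · rw [hgz i, add_comm, ← hcz i, ← Finset.sum_coe_sort U]
    congr 1
    exact (Equiv.sum_comp U.equivFin.symm fun a : U => c i a • (a : E)).symm

/-- Several outputs share one network of that depth, whose layers hold the finitely many functions
that the outputs involve. -/
theorem exists_mlp_of_mem_layerSpan {K : ℕ} (φ : Fin K → C(X, ℝ)) (σ : C(ℝ, ℝ)) (n : ℕ) {m : ℕ}
    {g : Fin m → C(X, ℝ)} (hg : ∀ i, g i ∈ layerSpan φ σ n) :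
    ∃ N : MLP K m, N.hiddenLayers = n ∧ ∀ x, N.eval σ (fun k => φ k x) = fun i => g i x := by
  induction n generalizing m with
  | zero =>
    choose b z hz hgz using fun i => Submodule.mem_span_insert.1 (hg i)
    choose c hc using fun i => (Submodule.mem_span_range_iff_exists_fun ℝ).1 (hz i)
    refine ⟨.output c b, rfl, fun x => funext fun i => ?_⟩
    simp [MLP.eval, hgz i, ← hc i, Matrix.mulVec, dotProduct, add_comm]
  | succ n ih =>
    obtain ⟨k, u, W, b, hu, hgu⟩ := exists_finite_affine_combination hg
    choose v hv hvu using hu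
    obtain ⟨N, hN, hNv⟩ := ih hv
    obtain ⟨N', hN', hNe⟩ := N.exists_snoc σ W b
    refine ⟨N', by rw [hN', hN], fun x => funext fun i => ?_⟩
    rw [hNe, hNv, hgu]
    simp [← hvu, Matrix.mulVec, dotProduct]

variable [CompactSpace X]

/-- Since `(σ (x₀ + h y) - σ x₀) / h → σ' (x₀) y`, a hidden layer can approximately pass its input
through, so that adding layers does not shrink the closure. -/
theorem layerSpan_le_closure_succ {K : ℕ} (φ : Fin K → C(X, ℝ)) {σ : C(ℝ, ℝ)} {x₀ : ℝ}
    (hd : DifferentiableAt ℝ σ x₀) (hne : deriv σ x₀ ≠ 0) (n : ℕ) :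
    layerSpan φ σ n ≤ (layerSpan φ σ (n + 1)).topologicalClosure := by
  intro g hg
  let q : C(ℝ, ℝ) := ⟨dslope σ x₀, continuous_iff_continuousAt.2 fun y => by
    rcases eq_or_ne y x₀ with rfl | hy
    · exact continuousAt_dslope_same.2 hd
    · exact (continuousAt_dslope_of_ne hy).2 σ.continuous.continuousAt⟩
  let Q : ℝ → C(X, ℝ) := fun h => (deriv σ x₀)⁻¹ • (q.comp (x₀ • 1 + h • g) * g)
  have hQ : Continuous Q := by
    have h1 : Continuous fun h : ℝ => x₀ • (1 : C(X, ℝ)) + h • g := by fun_prop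
    have h2 : Continuous fun h : ℝ => q.comp (x₀ • (1 : C(X, ℝ)) + h • g) :=
      (ContinuousMap.continuous_postcomp q).comp h1
    exact (h2.mul continuous_const).const_smul (deriv σ x₀)⁻¹
  have hQ0 : Q 0 = g := by
    ext x
    simp [Q, q, hne]
  have hQmem : ∀ h ≠ 0, Q h ∈ layerSpan φ σ (n + 1) := by
    intro h hh
    have : Q h = ((deriv σ x₀)⁻¹ * h⁻¹) • (σ.comp (x₀ • 1 + h • g) - σ x₀ • 1) := by
      ext x
      have := sub_smul_dslope σ x₀ (x₀ + h * g x)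
      simp only [add_sub_cancel_left, smul_eq_mul] at this
      simp only [Q, q, ContinuousMap.smul_apply, ContinuousMap.mul_apply, ContinuousMap.comp_apply,
        ContinuousMap.add_apply, ContinuousMap.one_apply, ContinuousMap.sub_apply, smul_eq_mul,
        mul_one, ContinuousMap.coe_mk, ← this]
      field_simp
    rw [this]
    exact Submodule.smul_mem _ _ (Submodule.sub_mem _
      (comp_mem_layerSpan (Submodule.add_mem _
        (Submodule.smul_mem _ _ (one_mem_layerSpan φ σ n)) (Submodule.smul_mem _ _ hg)))
      (Submodule.smul_mem _ _ (one_mem_layerSpan φ σ (n + 1))))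
  rw [← hQ0]
  refine mem_closure_of_tendsto (b := 𝓝[≠] (0 : ℝ))
    ((hQ.tendsto 0).mono_left nhdsWithin_le_nhds) ?_
  filter_upwards [self_mem_nhdsWithin] with h hh using hQmem h hh

theorem monotone_closure_layerSpan {K : ℕ} (φ : Fin K → C(X, ℝ)) {σ : C(ℝ, ℝ)} {x₀ : ℝ}
    (hd : DifferentiableAt ℝ σ x₀) (hne : deriv σ x₀ ≠ 0) :
    Monotone fun n => (layerSpan φ σ n).topologicalClosure :=
  monotone_nat_of_le_succ fun n =>
    Submodule.topologicalClosure_minimal _ (layerSpan_le_closure_succ φ hd hne n)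
      (Submodule.isClosed_topologicalClosure _)

theorem closure_iSup_layerSpan_eq_top {K : ℕ} (φ : Fin K → C(X, ℝ)) {σ : C(ℝ, ℝ)} {x₀ : ℝ}
    (hd : DifferentiableAt ℝ σ x₀) (hne : deriv σ x₀ ≠ 0)
    (hσ_nonaffine : ¬ ∃ a b : ℝ, ∀ x, σ x = a * x + b)
    (hφ : Function.Injective fun x k => φ k x) :
    (⨆ n, (layerSpan φ σ n).topologicalClosure).topologicalClosure = ⊤ := by
  have hmono := monotone_closure_layerSpan φ hd hne
  have hcomp : Continuous fun u : C(X, ℝ) => σ.comp u := ContinuousMap.continuous_postcomp σ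
  have hle : ∀ n, layerSpan φ σ n ≤
      (⨆ n, (layerSpan φ σ n).topologicalClosure).topologicalClosure := fun n =>
    (Submodule.le_topologicalClosure _).trans
      ((le_iSup (fun n => (layerSpan φ σ n).topologicalClosure) n).trans
        (Submodule.le_topologicalClosure _))
  refine eq_top_of_comp_mem (Submodule.isClosed_topologicalClosure _)
    (hle 0 (one_mem_layerSpan φ σ 0)) (σ := σ) (fun g hg => ?_) hσ_nonaffine fun x y hxy => ?_
  · refine map_mem_closure hcomp hg fun u hu => ?_
    obtain ⟨n, hn⟩ := (Submodule.mem_iSup_of_directed _ hmono.directed_le).1 hu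
    exact (le_iSup (fun n => (layerSpan φ σ n).topologicalClosure) (n + 1))
      (map_mem_closure hcomp hn fun v hv => comp_mem_layerSpan hv)
  · obtain ⟨k, hk⟩ : ∃ k, φ k x ≠ φ k y := by
      by_contra! H
      exact hxy (hφ (funext H))
    exact ⟨φ k, hle 0 (Submodule.subset_span (mem_insert_of_mem _ (mem_range_self k))), hk⟩

/-- **Universal approximation**: continuous maps `X → ℝ^m` on a compact space are uniform limits of
deep networks in features that separate points. -/
theorem exists_mlp_approx {K : ℕ} (φ : Fin K → C(X, ℝ)) {σ : C(ℝ, ℝ)} {x₀ : ℝ}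
    (hd : DifferentiableAt ℝ σ x₀) (hne : deriv σ x₀ ≠ 0)
    (hσ_nonaffine : ¬ ∃ a b : ℝ, ∀ x, σ x = a * x + b)
    (hφ : Function.Injective fun x k => φ k x) {m : ℕ} (g : Fin m → C(X, ℝ)) {δ : ℝ}
    (hδ : 0 < δ) :
    ∃ N : MLP K m, 1 ≤ N.hiddenLayers ∧
      ∀ x, dist (N.eval σ fun k => φ k x) (fun i => g i x) < δ := by
  have hmono := monotone_closure_layerSpan φ hd hne
  have h1 : ∀ i, ∃ n, ∃ u ∈ (layerSpan φ σ n).topologicalClosure, dist (g i) u < δ / 2 := by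
    intro i
    have hgi : g i ∈ (⨆ n, (layerSpan φ σ n).topologicalClosure).topologicalClosure := by
      rw [closure_iSup_layerSpan_eq_top φ hd hne hσ_nonaffine hφ]
      trivial
    obtain ⟨u, hu, hgu⟩ := Metric.mem_closure_iff.1 hgi (δ / 2) (half_pos hδ)
    obtain ⟨n, hn⟩ := (Submodule.mem_iSup_of_directed _ hmono.directed_le).1 hu
    exact ⟨n, u, hn, hgu⟩
  choose n u hu hgu using h1
  let M := Finset.univ.sup n + 1
  have h2 : ∀ i, ∃ v ∈ layerSpan φ σ M, dist (u i) v < δ / 2 := fun i =>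
    Metric.mem_closure_iff.1
      (hmono ((Finset.le_sup (f := n) (Finset.mem_univ i)).trans (Nat.le_succ _)) (hu i))
      (δ / 2) (half_pos hδ)
  choose v hv huv using h2
  obtain ⟨N, hN, hNv⟩ := exists_mlp_of_mem_layerSpan φ σ M hv
  refine ⟨N, by rw [hN]; exact Nat.le_add_left 1 _, fun x => ?_⟩
  rw [hNv, dist_pi_lt_iff hδ]
  intro i
  calc dist (v i x) (g i x) ≤ dist (v i) (g i) := ContinuousMap.dist_apply_le_dist x
    _ ≤ dist (v i) (u i) + dist (u i) (g i) := dist_triangle _ _ _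
    _ < δ := by
      have := hgu i
      have := huv i
      rw [dist_comm (v i), dist_comm (u i) (g i)]
      linarith

end Networks

/-! ### Networks as approximate measurable selectors -/

section Selection

/-- A finite measurable cover, each member labelled by a value, has a simple function that picks at
each point the label of a member containing that point. -/
theorem exists_simpleFunc_of_finite_cover {ι X E : Type*} [MeasurableSpace X] [Nonempty E]
    (t : Finset ι) {U : ι → Set X} (hU : ∀ i, MeasurableSet (U i)) (v : ι → E) :
    ∃ s : SimpleFunc X E, ∀ x, (∃ i ∈ t, x ∈ U i) → ∃ i ∈ t, x ∈ U i ∧ s x = v i := by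
  classical
  induction t using Finset.induction_on with
  | empty => exact ⟨.const X (Classical.arbitrary E), by simp⟩
  | insert j t _ ih =>
    obtain ⟨s, hs⟩ := ih
    refine ⟨.piecewise (U j) (hU j) (.const X (v j)) s, fun x hx => ?_⟩
    by_cases hj : x ∈ U j
    · exact ⟨j, Finset.mem_insert_self _ _, hj, by simp [hj]⟩
    · obtain ⟨i, hi, hxi⟩ := hx
      rcases Finset.mem_insert.1 hi with rfl | hi
      · exact absurd hxi hj
      · obtain ⟨i, hi, hxi, hsi⟩ := hs x ⟨i, hi, hxi⟩
        exact ⟨i, Finset.mem_insert_of_mem hi, hxi, by simp [hj, hsi]⟩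

variable {X : Type*} [TopologicalSpace X] [CompactSpace X] [MeasurableSpace X] [BorelSpace X]

/-- An open relation on `X × E` with non-empty fibres over a compact `X` has a simple selector
which stays a selector under all perturbations of size less than some uniform `δ`. -/
theorem exists_simpleFunc_ball_subset {E : Type*} [PseudoMetricSpace E] [Nonempty E]
    {O : Set (X × E)} (hO : IsOpen O) (hne : ∀ x, ∃ v, (x, v) ∈ O) :
    ∃ (s : SimpleFunc X E) (δ : ℝ), 0 < δ ∧ ∀ x v, dist v (s x) < δ → (x, v) ∈ O := by
  choose v hv using hne
  have hball : ∀ x, ∃ U : Set X, IsOpen U ∧ x ∈ U ∧ ∃ r > 0, U ×ˢ Metric.ball (v x) r ⊆ O := by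
    intro x
    obtain ⟨U, V, hU, hV, hxU, hvV, hUV⟩ := isOpen_prod_iff.1 hO x (v x) (hv x)
    obtain ⟨r, hr, hrV⟩ := Metric.isOpen_iff.1 hV (v x) hvV
    exact ⟨U, hU, hxU, r, hr, (prod_mono_right hrV).trans hUV⟩
  choose U hU hxU r hr hUO using hball
  obtain ⟨t, ht⟩ := CompactSpace.elim_nhds_subcover U fun x => (hU x).mem_nhds (hxU x)
  obtain ⟨s, hs⟩ := exists_simpleFunc_of_finite_cover t (fun x => (hU x).measurableSet) v
  obtain ⟨δ, hδr, hδ⟩ : ∃ δ : ℝ, (∀ i ∈ t, δ < r i) ∧ 0 < δ := by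
    have h1 : ∀ᶠ δ in 𝓝[>] (0 : ℝ), ∀ i ∈ t, δ < r i :=
      (Filter.eventually_all_finset t).2 fun i _ =>
        nhdsWithin_le_nhds (eventually_lt_nhds (hr i))
    exact (h1.and self_mem_nhdsWithin).exists
  refine ⟨s, δ, hδ, fun x w hw => ?_⟩
  have hx : x ∈ ⋃ i ∈ t, U i := by rw [ht]; trivial
  obtain ⟨i, hi, hxi, hsi⟩ := hs x (by simpa using hx)
  refine hUO i ⟨hxi, ?_⟩
  rw [hsi] at hw
  exact hw.trans (hδr i hi)

/-- An open relation with non-empty fibres over a compact probability space is satisfied by some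
deep network, outside a set of small probability. -/
theorem exists_mlp_measure_ge [TopologicalSpace.PseudoMetrizableSpace X] (P : Measure X)
    [IsProbabilityMeasure P] {K : ℕ} (φ : Fin K → C(X, ℝ)) {σ : C(ℝ, ℝ)} {x₀ : ℝ}
    (hd : DifferentiableAt ℝ σ x₀) (hσ' : deriv σ x₀ ≠ 0)
    (hσ_nonaffine : ¬ ∃ a b : ℝ, ∀ x, σ x = a * x + b)
    (hφ : Function.Injective fun x k => φ k x) {m : ℕ} {O : Set (X × (Fin m → ℝ))}
    (hO : IsOpen O) (hne : ∀ x, ∃ v, (x, v) ∈ O) {ε : ℝ} (hε : 0 < ε) :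
    ∃ N : MLP K m, 1 ≤ N.hiddenLayers ∧
      ENNReal.ofReal (1 - ε) ≤ P {x | (x, N.eval σ fun k => φ k x) ∈ O} := by
  let := TopologicalSpace.pseudoMetrizableSpacePseudoMetric X
  obtain ⟨s, δ, hδ, hs⟩ := exists_simpleFunc_ball_subset hO hne
  have hδ' : ENNReal.ofReal (δ / 2) ≠ 0 := by simpa using hδ
  -- the `L¹` accuracy for which Markov's inequality at level `δ / 2` gives probability `ε`
  have hη : ENNReal.ofReal (δ / 2) * ENNReal.ofReal ε ≠ 0 := mul_ne_zero hδ' (by simpa using hε)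
  obtain ⟨g, hg, hgL⟩ := (s.memLp_of_isFiniteMeasure 1 P).exists_boundedContinuous_eLpNorm_sub_le
    ENNReal.one_ne_top hη
  have hbad : P {x | ENNReal.ofReal (δ / 2) ≤ ‖(s - g : X → Fin m → ℝ) x‖ₑ} ≤ ENNReal.ofReal ε := by
    have h1 := meas_ge_le_mul_pow_eLpNorm_enorm P one_ne_zero ENNReal.one_ne_top
      ((s.memLp_of_isFiniteMeasure 1 P).sub hgL).aestronglyMeasurable hδ' (by simp)
    simp only [ENNReal.toReal_one, ENNReal.rpow_one] at h1
    refine h1.trans ((mul_le_mul_right hg _).trans ?_)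
    rw [← mul_assoc, ENNReal.inv_mul_cancel hδ' ENNReal.ofReal_ne_top, one_mul]
  obtain ⟨N, hN, hNg⟩ := exists_mlp_approx φ hd hσ' hσ_nonaffine hφ
    (fun i => ⟨fun x => g x i, (continuous_apply i).comp g.continuous⟩) (half_pos hδ)
  refine ⟨N, hN, ?_⟩
  rw [ENNReal.ofReal_sub _ hε.le, ENNReal.ofReal_one, tsub_le_iff_right, ← measure_univ (μ := P)]
  refine (measure_mono fun x _ => ?_).trans ((measure_union_le _ _).trans
    (add_le_add_right hbad _))
  by_contra hx
  simp only [mem_union, mem_ofPred_eq, not_or, not_le] at hx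
  refine hx.1 (hs x _ ?_)
  have h1 : dist (g x) (s x) < δ / 2 := by
    have := hx.2
    rw [← ofReal_norm, ENNReal.ofReal_lt_ofReal_iff (half_pos hδ)] at this
    rwa [dist_comm, dist_eq_norm]
  have h2 : dist (N.eval σ fun k => φ k x) (g x) < δ / 2 := hNg x
  linarith [dist_triangle (N.eval σ fun k => φ k x) (g x) (s x)]

end Selection

/-! ### Continuity of the expected loss -/

section Loss

/-- The pairing of probability measures (weak topology) with bounded continuous functions (uniform
topology) is jointly continuous. -/
theorem continuous_integral_probabilityMeasure_prod {Z : Type*} [TopologicalSpace Z]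
    [MeasurableSpace Z] [OpensMeasurableSpace Z] :
    Continuous fun q : ProbabilityMeasure Z × BoundedContinuousFunction Z ℝ =>
      ∫ z, q.2 z ∂(q.1 : Measure Z) := by
  rw [continuous_iff_continuousAt]
  rintro ⟨μ₀, g₀⟩
  have h1 : Tendsto (fun q : ProbabilityMeasure Z × BoundedContinuousFunction Z ℝ =>
      ∫ z, g₀ z ∂(q.1 : Measure Z)) (𝓝 (μ₀, g₀)) (𝓝 (∫ z, g₀ z ∂(μ₀ : Measure Z))) :=
    ((ProbabilityMeasure.continuous_integral_boundedContinuousFunction g₀).comp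
      continuous_fst).tendsto (μ₀, g₀)
  have h2 : Tendsto (fun q : ProbabilityMeasure Z × BoundedContinuousFunction Z ℝ =>
      ∫ z, (q.2 - g₀) z ∂(q.1 : Measure Z)) (𝓝 (μ₀, g₀)) (𝓝 0) := by
    refine squeeze_zero_norm (a := fun q => ‖q.2 - g₀‖)
      (fun q => (q.2 - g₀).norm_integral_le_norm _) ?_
    have : Continuous fun q : ProbabilityMeasure Z × BoundedContinuousFunction Z ℝ =>
        ‖q.2 - g₀‖ := by fun_prop
    simpa using this.tendsto (μ₀, g₀)
  have h3 := h1.add h2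
  rw [add_zero] at h3
  refine h3.congr fun q => ?_
  rw [← integral_add (g₀.integrable _) ((q.2 - g₀).integrable _)]
  simp

theorem continuous_expectedLoss {d m p : ℕ} {ℓ : (Fin m → ℝ) → (Fin m → ℝ) → ℝ}
    (hℓ : Continuous fun q : (Fin m → ℝ) × (Fin m → ℝ) => ℓ q.1 q.2)
    {f : (Fin p → ℝ) → (Fin d → ℝ) → (Fin m → ℝ)}
    (hf : Continuous fun q : (Fin p → ℝ) × (Fin d → ℝ) => f q.1 q.2) (θ₀ : Fin p → ℝ) :
    Continuous fun q : ProbabilityMeasure (DataDomain d m) × (Fin p → ℝ) =>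
      expectedLoss ℓ f θ₀ q.1 q.2 := by
  have hin : Continuous fun z : DataDomain d m => inputOf z :=
    continuous_pi fun i => continuous_subtype_val.comp (continuous_apply _)
  have hlab : Continuous fun z : DataDomain d m => labelOf z :=
    continuous_pi fun i => continuous_subtype_val.comp (continuous_apply _)
  let F : C((Fin p → ℝ) × DataDomain d m, ℝ) :=
    ⟨fun q => ℓ (f (θ₀ + q.1) (inputOf q.2)) (labelOf q.2),
      hℓ.comp ((hf.comp ((continuous_const.add continuous_fst).prodMk
        (hin.comp continuous_snd))).prodMk (hlab.comp continuous_snd))⟩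
  have hF : Continuous fun ϑ => BoundedContinuousFunction.mkOfCompact (F.curry ϑ) :=
    (ContinuousMap.isometryEquivBoundedOfCompact _ _).continuous.comp F.curry.continuous
  exact continuous_integral_probabilityMeasure_prod.comp
    (continuous_fst.prodMk (hF.comp continuous_snd))

end Loss

/-! ### Mixtures with softmin weights -/

section Mixtures

theorem continuous_mixture {K p : ℕ} (Δθ : Fin K → Fin p → ℝ) :
    Continuous fun w : Fin K → ℝ => mixture w Δθ := by
  unfold mixture
  fun_prop

theorem isCompact_coHull {K p : ℕ} (Δθ : Fin K → Fin p → ℝ) : IsCompact (coHull Δθ) := by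
  have : coHull Δθ = (fun w => mixture w Δθ) '' stdSimplex ℝ (Fin K) := by
    ext ϑ
    simp [coHull, eq_comm]
  rw [this]
  exact (isCompact_stdSimplex ℝ (Fin K)).image (continuous_mixture Δθ)

theorem coHull_nonempty {K p : ℕ} (hK : 0 < K) (Δθ : Fin K → Fin p → ℝ) :
    (coHull Δθ).Nonempty :=
  ⟨_, _, single_mem_stdSimplex ℝ (⟨0, hK⟩ : Fin K), rfl⟩

theorem continuous_softmin {K : ℕ} : Continuous (softmin : (Fin K → ℝ) → Fin K → ℝ) := by
  refine continuous_pi fun k => ?_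
  have : Nonempty (Fin K) := ⟨k⟩
  have hpos : ∀ w : Fin K → ℝ, ∑ i, Real.exp (-w i) ≠ 0 := fun w =>
    (Finset.sum_pos (fun i _ => Real.exp_pos _) Finset.univ_nonempty).ne'
  unfold softmin
  exact Continuous.div (by fun_prop) (by fun_prop) hpos

theorem softmin_neg_log {K : ℕ} {w : Fin K → ℝ} (hpos : ∀ k, 0 < w k) (hsum : ∑ k, w k = 1) :
    softmin (fun k => -Real.log (w k)) = w := by
  funext k
  simp [softmin, Real.exp_log (hpos _), hsum]

/-- Softmin weights are dense in the simplex: a strict upper bound for a continuous function that is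
attained on `co(Δθ)` is attained at a softmin mixture. -/
theorem exists_softmin_mixture_lt {K p : ℕ} {Δθ : Fin K → Fin p → ℝ} {G : (Fin p → ℝ) → ℝ}
    (hG : Continuous G) {c : ℝ} {ϑ : Fin p → ℝ} (hϑ : ϑ ∈ coHull Δθ) (hc : G ϑ < c) :
    ∃ v : Fin K → ℝ, G (mixture (softmin v) Δθ) < c := by
  obtain ⟨w, ⟨hw0, hw1⟩, rfl⟩ := hϑ
  have hK : (K : ℝ) ≠ 0 := by
    rintro hK
    obtain rfl : K = 0 := by exact_mod_cast hK
    simp at hw1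
  have hK' : (0 : ℝ) < K := lt_of_le_of_ne (Nat.cast_nonneg K) hK.symm
  -- move `w` slightly towards the barycentre of the simplex
  let u : ℝ → Fin K → ℝ := fun t k => (1 - t) * w k + t * (K : ℝ)⁻¹
  have hu : Continuous fun t => G (mixture (u t) Δθ) :=
    hG.comp ((continuous_mixture Δθ).comp (by fun_prop))
  have hu0 : u 0 = w := by simp [u]
  have hlt : ∀ᶠ t in 𝓝[>] (0 : ℝ), G (mixture (u t) Δθ) < c :=
    nhdsWithin_le_nhds ((hu.tendsto 0).eventually_lt_const (by simpa only [hu0] using hc))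
  have hone : ∀ᶠ t in 𝓝[>] (0 : ℝ), t < 1 :=
    nhdsWithin_le_nhds (eventually_lt_nhds one_pos)
  obtain ⟨t, ⟨htc, ht1⟩, ht0⟩ := ((hlt.and hone).and self_mem_nhdsWithin).exists
  have ht0 : 0 < t := ht0
  refine ⟨fun k => -Real.log (u t k), ?_⟩
  rw [softmin_neg_log]
  · exact htc
  · intro k
    have := mul_nonneg (sub_nonneg.2 ht1.le) (hw0 k)
    positivity
  · simp only [u, Finset.sum_add_distrib, ← Finset.mul_sum, hw1, Finset.sum_const,
      Finset.card_univ, Fintype.card_fin, nsmul_eq_mul]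
    field_simp
    ring

end Mixtures

/-! ### Cheap fine-tuning -/

theorem Metrizes.continuous_left {α : Type*} [TopologicalSpace α] {ρ : α → α → ℝ}
    (hρ : Metrizes ρ) (y : α) : Continuous fun x => ρ x y := by
  rw [continuous_iff_continuousAt]
  intro x
  rw [ContinuousAt, Metric.tendsto_nhds]
  intro r hr
  have hopen : IsOpen {z | ρ x z < r} := by
    rw [hρ.isOpen_iff]
    intro z hz
    refine ⟨r - ρ x z, sub_pos.2 hz, fun z' hz' => ?_⟩
    have := hρ.dist_triangle x z z'
    simp only [mem_ofPred_eq] at *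
    linarith
  filter_upwards [hopen.mem_nhds (by simpa [hρ.dist_self] using hr)] with z hz
  have h1 := hρ.dist_triangle x z y
  have h2 := hρ.dist_triangle z x y
  rw [hρ.dist_comm z x] at h2
  have hz : ρ x z < r := hz
  rw [Real.dist_eq, abs_lt]
  constructor <;> linarith

theorem MLP.continuous_eval {σ : ℝ → ℝ} (hσ : Continuous σ) {n m : ℕ} (N : MLP n m) :
    Continuous (N.eval σ) := by
  induction N with
  | output W b =>
    exact (Continuous.matrix_mulVec continuous_const continuous_id).add continuous_const
  | hidden W b N ih =>
    refine ih.comp (continuous_pi fun i => hσ.comp ?_)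
    exact (continuous_apply i).comp
      ((Continuous.matrix_mulVec continuous_const continuous_id).add continuous_const)

end

theorem mainTheorem1 {d m p K : ℕ} (hd : 0 < d) (hm : 0 < m) (hK : 0 < K)
    -- the loss function, the model and the pre-trained parameter
    (ℓ : (Fin m → ℝ) → (Fin m → ℝ) → ℝ) (hℓ_nonneg : ∀ y y', 0 ≤ ℓ y y')
    (hℓ : ∃ C, LipschitzWith C (fun q : (Fin m → ℝ) × (Fin m → ℝ) => ℓ q.1 q.2))
    (f : (Fin p → ℝ) → (Fin d → ℝ) → (Fin m → ℝ))
    (hf : LocallyLipschitz (fun q : (Fin p → ℝ) × (Fin d → ℝ) => f q.1 q.2))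
    (θ₀ : Fin p → ℝ)
    -- the compact space of datasets, with a metric of weak convergence
    (𝒟 : Set (ProbabilityMeasure (DataDomain d m))) (h𝒟 : IsCompact 𝒟)
    (ρ : 𝒟 → 𝒟 → ℝ) (hρ : Metrizes ρ)
    -- the task distribution, a Borel probability measure on the space of datasets
    (P : @Measure 𝒟 (borel 𝒟)) (hP : @IsProbabilityMeasure 𝒟 (borel 𝒟) P)
    -- the datasets with their fine-tuned parameters
    (D : Fin K → 𝒟) (Δθ : Fin K → Fin p → ℝ)
    (h_align : Function.Injective (align ρ D))
    -- the activation function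
    (σ : ℝ → ℝ) (hσ : ∃ C, LipschitzWith C σ)
    (hσ_deriv : ∃ x, DifferentiableAt ℝ σ x ∧ deriv σ x ≠ 0)
    (hσ_nonaffine : ¬ ∃ a b : ℝ, ∀ x, σ x = a * x + b)
    (ε : ℝ) (hε : 0 < ε) (hε1 : ε ≤ 1) :
    ∃ N : MLP K K, 1 ≤ N.hiddenLayers ∧
      MeasurableSet[borel 𝒟] {μ : 𝒟 |
        expectedLoss ℓ f θ₀ μ (cheapFineTuning σ N ρ D Δθ μ) ≤
          (⨅ ϑ : coHull Δθ, expectedLoss ℓ f θ₀ μ ϑ) + ε} ∧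
      ENNReal.ofReal (1 - ε) ≤ P {μ : 𝒟 |
        expectedLoss ℓ f θ₀ μ (cheapFineTuning σ N ρ D Δθ μ) ≤
          (⨅ ϑ : coHull Δθ, expectedLoss ℓ f θ₀ μ ϑ) + ε} := by
  obtain ⟨Cℓ, hℓ⟩ := hℓ
  obtain ⟨Cσ, hσ⟩ := hσ
  obtain ⟨x₀, hd₀, hσ'⟩ := hσ_deriv
  -- the task distribution lives on `borel 𝒟`, which must take precedence over the subtype instance
  let : MeasurableSpace 𝒟 := borel 𝒟
  have : BorelSpace 𝒟 := ⟨rfl⟩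
  have : CompactSpace 𝒟 := isCompact_iff_compactSpace.1 h𝒟
  have : IsProbabilityMeasure P := hP
  have hL : Continuous fun q : 𝒟 × (Fin p → ℝ) => expectedLoss ℓ f θ₀ q.1 q.2 :=
    (continuous_expectedLoss hℓ.continuous hf.continuous θ₀).comp
      (continuous_subtype_val.prodMap continuous_id)
  let J : 𝒟 → ℝ := fun μ => ⨅ ϑ : coHull Δθ, expectedLoss ℓ f θ₀ μ ϑ
  have hJ_eq : ∀ μ : 𝒟, J μ = sInf (expectedLoss ℓ f θ₀ μ '' coHull Δθ) :=
    fun μ => sInf_image'.symm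
  have hJ : Continuous J := by
    rw [show J = _ from funext hJ_eq]
    exact (isCompact_coHull Δθ).continuous_sInf
      (f := fun (μ : 𝒟) ϑ => expectedLoss ℓ f θ₀ μ ϑ) hL
  have hHv : Continuous fun q : 𝒟 × (Fin K → ℝ) =>
      expectedLoss ℓ f θ₀ q.1 (mixture (softmin q.2) Δθ) :=
    hL.comp (continuous_fst.prodMk
      ((continuous_mixture Δθ).comp (continuous_softmin.comp continuous_snd)))
  let φ : Fin K → C(𝒟, ℝ) := fun k => ⟨fun μ => ρ μ (D k), hρ.continuous_left (D k)⟩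
  -- strict inequality with `J` continuous makes the relation open, as the selection needs
  obtain ⟨N, hN, hNP⟩ := exists_mlp_measure_ge P φ (σ := ⟨σ, hσ.continuous⟩) hd₀ hσ' hσ_nonaffine
    h_align (O := {q | expectedLoss ℓ f θ₀ q.1 (mixture (softmin q.2) Δθ) < J q.1 + ε})
    (isOpen_lt hHv ((hJ.comp continuous_fst).add continuous_const))
    (fun μ => by
      have hlt : sInf (expectedLoss ℓ f θ₀ μ '' coHull Δθ) < J μ + ε := by
        rw [← hJ_eq]
        exact lt_add_of_pos_right _ hε
      obtain ⟨_, ⟨ϑ, hϑ, rfl⟩, hϑlt⟩ := exists_lt_of_csInf_lt ((coHull_nonempty hK Δθ).image _) hlt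
      exact exists_softmin_mixture_lt (hL.comp (continuous_const.prodMk continuous_id)) hϑ hϑlt) hε
  have hsub : {μ : 𝒟 | (μ, N.eval σ fun k => φ k μ) ∈
        {q : 𝒟 × (Fin K → ℝ) |
          expectedLoss ℓ f θ₀ q.1 (mixture (softmin q.2) Δθ) < J q.1 + ε}} ⊆
      {μ : 𝒟 | expectedLoss ℓ f θ₀ μ (cheapFineTuning σ N ρ D Δθ μ) ≤ J μ + ε} :=
    fun μ hμ => (show expectedLoss ℓ f θ₀ μ (cheapFineTuning σ N ρ D Δθ μ) < J μ + ε from hμ).le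
  refine ⟨N, hN, ?_, hNP.trans (measure_mono hsub)⟩
  have hNc : Continuous fun μ : 𝒟 => N.eval σ (align ρ D μ) :=
    (N.continuous_eval hσ.continuous).comp
      (continuous_pi fun k => hρ.continuous_left (D k))
  exact (isClosed_le (hHv.comp (continuous_id.prodMk hNc))
    (hJ.add continuous_const)).measurableSet
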